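/- Let $A$ and $B$ be finite-dimensional quantum systems, let $\rho_{AB}$ be a density operator on $A\otimes B$ (positive semidefinite with trace one), and let $\rho_B$ be its partial trace over $A$. Let $\log$ denote the logarithm in base $2$ and $\ln$ the natural logarithm. Logarithms and real powers of positive semidefinite operators are taken on their supports (and are zero on the kernels). For a density operator $\rho$ and a positive semidefinite operator $\sigma$ with $\mathrm{supp}(\rho)\subseteq\mathrm{supp}(\sigma)$, put $$D(\rho\|\sigma)=\mathrm{tr}[\rho(\log\rho-\log\sigma)],\qquad V(\rho\|\sigma)=\mathrm{tr}\big[\rho(\log\rho-\log\sigma-D(\rho\|\sigma)\,\mathrm{id})^2\big],$$ and, for $\alpha>1$, $$D_\alpha(\rho\|\sigma)=\tfrac{1}{\alpha-1}\log\mathrm{tr}\Big[\big(\sigma^{-\frac{\alpha-1}{2\alpha}}\rho\,\sigma^{-\frac{\alpha-1}{2\alpha}}\big)^{\alpha}\Big],\qquad D'_\alpha(\rho\|\sigma)=\tfrac{1}{\alpha-1}\log\mathrm{tr}\big[\rho^{\alpha}\sigma^{1-\alpha}\big]\quad(\text{the latter for }\alpha\le 2);$$ if $\mathrm{supp}(\rho)\not\subseteq\mathrm{supp}(\sigma)$,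 then $D$, $D_\alpha$ and $D'_\alpha$ are $\infty$. Define $H(A|B)_\rho=-D(\rho_{AB}\|\mathrm{id}_A\otimes\rho_B)$, $H_\alpha(A|B)_\rho=-D_\alpha(\rho_{AB}\|\mathrm{id}_A\otimes\rho_B)$, $H'_\alpha(A|B)_\rho=-D'_\alpha(\rho_{AB}\|\mathrm{id}_A\otimes\rho_B)$ and $V(A|B)_\rho=V(\rho_{AB}\|\mathrm{id}_A\otimes\rho_B)$. Then for every $\alpha\in(1,2)$ the entropies $H(A|B)_\rho$, $H_\alpha(A|B)_\rho$, $H'_\alpha(A|B)_\rho$ and $H'_2(A|B)_\rho$ are finite, and $$H_\alpha(A|B)_\rho\;\ge\;H(A|B)_\rho-\frac{(\alpha-1)\ln 2}{2}\,V(A|B)_\rho-(\alpha-1)^2K(\alpha),$$ where $$K(\alpha)=\frac{1}{6(2-\alpha)^3\ln 2}\cdot 2^{(\alpha-1)\left(-H'_\alpha(A|B)_\rho+H(A|B)_\rho\right)}\,\ln^3\!\left(2^{-H'_2(A|B)_\rho+H(A|B)_\rho}+e^2\right).$$ -/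

import Mathlib

open scoped ComplexOrder Kronecker

noncomputable section

namespace QEntropy

variable {n A B : Type*} [Fintype n] [DecidableEq n] [Fintype A] [DecidableEq A]
  [Fintype B] [DecidableEq B]

/-- A (normalized) density operator: positive semidefinite with trace one. -/
def IsDensity (ρ : Matrix n n ℂ) : Prop := ρ.PosSemidef ∧ ρ.trace = 1

/-- The support of an operator: the orthogonal complement of its kernel. -/
def supp (M : Matrix n n ℂ) : Submodule ℂ (EuclideanSpace ℂ n) :=
  (LinearMap.ker (Matrix.toEuclideanLin M))ᗮ

/-- Base-two logarithm of a positive semidefinite operator, by functional calculus on its support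
and zero on its kernel (`Real.logb 2 0 = 0`). -/
def mlog (M : Matrix n n ℂ) : Matrix n n ℂ := cfc (Real.logb 2) M

/-- Real power of a positive semidefinite operator, taken on its support: eigenvalues `x > 0` become
`x ^ s` and the kernel is sent to zero, for every real `s` (so `s = 0` gives the projector onto the
support, and negative powers are generalized inverses). -/
def mpow (M : Matrix n n ℂ) (s : ℝ) : Matrix n n ℂ :=
  cfc (fun x : ℝ => if x = 0 then 0 else x ^ s) M

open Classical in
/-- Relative entropy `D(ρ‖σ)` of positive semidefinite operators. The trace in it is a real number,
as `ρ` and `log ρ - log σ` are Hermitian. -/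
def relEntropy (ρ σ : Matrix n n ℂ) : EReal :=
  if supp ρ ≤ supp σ then
    ((1 / ρ.trace.re * (ρ * (mlog ρ - mlog σ)).trace.re : ℝ) : EReal)
  else ⊤

/-- The trace `tr[(σ^(-α'/2) ρ σ^(-α'/2))^α]` with `α' = (α - 1) / α`. -/
def sandwichedTrace (α : ℝ) (ρ σ : Matrix n n ℂ) : ℝ :=
  (mpow (mpow σ (-((α - 1) / α) / 2) * ρ * mpow σ (-((α - 1) / α) / 2)) α).trace.re

/-- The trace `tr[ρ^α σ^(1-α)]`. -/
def petzTrace (α : ℝ) (ρ σ : Matrix n n ℂ) : ℝ :=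
  (mpow ρ α * mpow σ (1 - α)).trace.re

open Classical in
/-- Sandwiched Rényi divergence `D_α(ρ‖σ)` of a state `ρ` and a positive semidefinite `σ`, for finite
`α ≥ 1/2`. For `α < 1` and a vanishing trace it is `∞`, that is `(α - 1)⁻¹ log 0`. -/
def sandwichedDiv (α : ℝ) (ρ σ : Matrix n n ℂ) : EReal :=
  if α = 1 then relEntropy ρ σ
  else if (α < 1 ∧ sandwichedTrace α ρ σ ≠ 0) ∨ (1 < α ∧ supp ρ ≤ supp σ) then
    ((1 / (α - 1) * Real.logb 2 (sandwichedTrace α ρ σ) : ℝ) : EReal)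
  else ⊤

open Classical in
/-- Petz Rényi divergence `D'_α(ρ‖σ)` of a state `ρ` and a positive semidefinite `σ`, for
`0 ≤ α ≤ 2`. At `α = 0` the formula is `-log tr[Π σ]` with `Π` the projector onto the support
of `ρ`. For `α < 1` and a vanishing trace the value is `∞`, that is `(α - 1)⁻¹ log 0`. -/
def petzDiv (α : ℝ) (ρ σ : Matrix n n ℂ) : EReal :=
  if α = 1 then relEntropy ρ σ
  else if (α < 1 ∧ petzTrace α ρ σ ≠ 0) ∨ (1 < α ∧ supp ρ ≤ supp σ) then
    ((1 / (α - 1) * Real.logb 2 (petzTrace α ρ σ) : ℝ) : EReal)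
  else ⊤

/-- Quantum divergence variance `V(ρ‖σ)`, for positive semidefinite operators with `D(ρ‖σ)` finite. -/
def divVariance (ρ σ : Matrix n n ℂ) : ℝ :=
  1 / ρ.trace.re *
    (ρ * (mlog ρ - mlog σ - (((relEntropy ρ σ).toReal : ℝ) : ℂ) • (1 : Matrix n n ℂ)) ^ 2).trace.re

/-- The marginal `ρ_B` of a bipartite operator: the partial trace over `A`. -/
def marginalB (ρ : Matrix (A × B) (A × B) ℂ) : Matrix B B ℂ :=
  Matrix.of fun b b' => ∑ a, ρ (a, b) (a, b')

/-- The operator `id_A ⊗ ρ_B`. -/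
def idTensorMarginal (ρ : Matrix (A × B) (A × B) ℂ) : Matrix (A × B) (A × B) ℂ :=
  (1 : Matrix A A ℂ) ⊗ₖ marginalB ρ

/-- Conditional von Neumann entropy `H(A|B)_ρ`. -/
def condEntropy (ρ : Matrix (A × B) (A × B) ℂ) : EReal :=
  -relEntropy ρ (idTensorMarginal ρ)

/-- Sandwiched Rényi conditional entropy `H_α(A|B)_ρ`. -/
def sandwichedCondEntropy (α : ℝ) (ρ : Matrix (A × B) (A × B) ℂ) : EReal :=
  -sandwichedDiv α ρ (idTensorMarginal ρ)

/-- Petz Rényi conditional entropy `H'_α(A|B)_ρ`. -/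
def petzCondEntropy (α : ℝ) (ρ : Matrix (A × B) (A × B) ℂ) : EReal :=
  -petzDiv α ρ (idTensorMarginal ρ)

/-- Conditional entropy variance `V(A|B)_ρ`. -/
def condVariance (ρ : Matrix (A × B) (A × B) ℂ) : ℝ :=
  divVariance ρ (idTensorMarginal ρ)

end QEntropy

end

open scoped ComplexOrder Kronecker

set_option linter.unusedSectionVars false

noncomputable section

namespace QEntropy

open Matrix

/-! The argument is an upper bound on `D_α(ρ‖σ)` for `σ = id_A ⊗ ρ_B`. Araki-Lieb-Thirring gives
`D_α ≤ D'_α`, and the Petz quantity is classical. With eigenvalues `λ_i` of `ρ` and `μ_j` of `σ`,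
the weights `p_ij = λ_i |⟨i|j⟩|²` form a probability distribution. Under it `r_ij = log λ_i - log
μ_j` has mean `D` and variance `V`, and `tr[ρ^α σ^(1-α)] = ∑ p 2^((α-1) r)`
(`trace_mul_mlog_sub_mlog`, `trace_mul_sq_mlog_sub_mlog`, `petzTrace_eq_sum`).

It remains to bound the cumulant generating function of `Y = ln 2 · (r - D)` at `β = α - 1`
(`log_sum_exp_le`). Put `T = E[e^(βY)]`. Then `ln T ≤ T - 1`, and Taylor's formula leaves a
remainder governed by `E[e^(βY) max(Y,0)³]`. Since `(1-β) max(Y,0) ≤ ln(e^((1-β)Y) + e²)` and `ln³`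
is concave on `[e², ∞)`, Jensen's inequality for the weights `p e^(βY) / T` bounds this by `(1-β)⁻³
T ln³(E[e^Y] + e²)`. Here `T = 2^((α-1)(D'_α - D))` and `E[e^Y] = 2^(D'_2 - D)`, which are the
quantities in `K(α)`.

Araki-Lieb-Thirring (`trace_pow_le_trace_pow_mul_pow`) comes from the three-lines theorem, with
Cauchy-Schwarz for the Hilbert-Schmidt norm on both edges of the strip. -/

/-! ### Scalar inequalities and the cumulant generating function. -/

/-- Third-order upper bound on the exponential, with a remainder only for positive arguments. -/
theorem exp_le_quadratic_add (u : ℝ) :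
    Real.exp u ≤ 1 + u + u ^ 2 / 2 + max u 0 ^ 3 / 6 * Real.exp u := by
  -- After multiplying by `e^(-u)` the derivatives collapse: `e^(-x) (1 + x + x²/2)` has derivative
  -- `-e^(-x) x²/2`, so it decreases to its value `1` at `0` from the left, and adding `x³/6` makes
  -- it increasing on the right.
  have key : 1 ≤ Real.exp (-u) * (1 + u + u ^ 2 / 2) + max u 0 ^ 3 / 6 := by
    rcases le_total 0 u with hu | hu
    · rw [max_eq_left hu]
      have hd : ∀ x : ℝ, HasDerivAt (fun x : ℝ => Real.exp (-x) * (1 + x + x ^ 2 / 2) + x ^ 3 / 6)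
          ((1 - Real.exp (-x)) * (x ^ 2 / 2)) x := fun x => by
        have h1 := ((hasDerivAt_id x).neg).exp
        have h2 := (((hasDerivAt_id x).const_add 1).add (((hasDerivAt_id x).pow 2).div_const 2))
        have h3 := ((hasDerivAt_id x).pow 3).div_const 6
        refine ((h1.mul h2).add h3).congr_deriv ?_
        simp
        ring
      have hmono := monotoneOn_of_deriv_nonneg (convex_Ici (0 : ℝ))
        (fun x _ => (hd x).continuousAt.continuousWithinAt)
        (fun x _ => (hd x).differentiableAt.differentiableWithinAt) (fun x hx => by
          rw [(hd x).deriv]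
          rw [interior_Ici] at hx
          have : Real.exp (-x) ≤ 1 := Real.exp_le_one_iff.2 (by linarith [Set.mem_Ioi.1 hx])
          exact mul_nonneg (by linarith) (by positivity))
      simpa using hmono (Set.mem_Ici.2 le_rfl) (Set.mem_Ici.2 hu) hu
    · rw [max_eq_right hu]
      have hd : ∀ x : ℝ, HasDerivAt (fun x : ℝ => Real.exp (-x) * (1 + x + x ^ 2 / 2))
          (-(Real.exp (-x) * (x ^ 2 / 2))) x := fun x => by
        have h1 := ((hasDerivAt_id x).neg).exp
        have h2 := (((hasDerivAt_id x).const_add 1).add (((hasDerivAt_id x).pow 2).div_const 2))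
        refine (h1.mul h2).congr_deriv ?_
        simp
        ring
      have hanti := antitone_of_deriv_nonpos (fun x => (hd x).differentiableAt) (fun x => by
        rw [(hd x).deriv]
        exact neg_nonpos.2 (by positivity))
      simpa using hanti hu
  have hpos := Real.exp_pos u
  have h1 : Real.exp u * Real.exp (-u) = 1 := by rw [← Real.exp_add]; simp
  calc Real.exp u = Real.exp u * 1 := (mul_one _).symm
    _ ≤ Real.exp u * (Real.exp (-u) * (1 + u + u ^ 2 / 2) + max u 0 ^ 3 / 6) := by gcongr
    _ = (Real.exp u * Real.exp (-u)) * (1 + u + u ^ 2 / 2)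
          + max u 0 ^ 3 / 6 * Real.exp u := by ring
    _ = _ := by rw [h1, one_mul]

/-- The second derivative `3 ln x (2 - ln x) / x²` is nonpositive once `ln x ≥ 2`; this is where the
shift `e²` in the final bound comes from. -/
theorem concaveOn_log_pow_three :
    ConcaveOn ℝ (Set.Ici (Real.exp 1 ^ 2)) (fun x : ℝ => Real.log x ^ 3) := by
  have hpos : ∀ x ∈ Set.Ici (Real.exp 1 ^ 2), (0 : ℝ) < x := fun x hx =>
    lt_of_lt_of_le (by positivity) (Set.mem_Ici.1 hx)
  have hd : ∀ x : ℝ, 0 < x →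
      HasDerivAt (fun x : ℝ => Real.log x ^ 3) (3 * Real.log x ^ 2 / x) x := fun x hx => by
    refine ((Real.hasDerivAt_log hx.ne').pow 3).congr_deriv ?_
    simp
    ring
  have hd2 : ∀ x : ℝ, 0 < x → HasDerivAt (fun x : ℝ => 3 * Real.log x ^ 2 / x)
      (3 * Real.log x * (2 - Real.log x) / x ^ 2) x := fun x hx => by
    refine ((((Real.hasDerivAt_log hx.ne').pow 2).const_mul 3).div (hasDerivAt_id x)
      hx.ne').congr_deriv ?_
    simp
    field_simp
  refine concaveOn_of_hasDerivWithinAt2_nonpos (convex_Ici _)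
    (fun x hx => (hd x (hpos x hx)).continuousAt.continuousWithinAt)
    (fun x hx => (hd x (hpos x (interior_subset hx))).hasDerivWithinAt)
    (fun x hx => (hd2 x (hpos x (interior_subset hx))).hasDerivWithinAt) (fun x hx => ?_)
  have hx' := interior_subset hx
  have hlog : 2 ≤ Real.log x := by
    rw [Real.le_log_iff_exp_le (hpos x hx')]
    refine le_trans (le_of_eq ?_) (Set.mem_Ici.1 hx')
    rw [← Real.exp_nat_mul]
    norm_num
  exact div_nonpos_of_nonpos_of_nonneg (by nlinarith) (by positivity)

/-- Second-order bound on the cumulant generating function of a centred random variable. -/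
theorem log_sum_exp_le {ι : Type*} [Fintype ι] (p Y : ι → ℝ) (hp : ∀ i, 0 ≤ p i)
    (hp1 : ∑ i, p i = 1) (hY : ∑ i, p i * Y i = 0) {β : ℝ} (hβ : 0 < β) (hβ1 : β < 1) :
    Real.log (∑ i, p i * Real.exp (β * Y i)) ≤
      β ^ 2 / 2 * ∑ i, p i * Y i ^ 2 + β ^ 3 / (6 * (1 - β) ^ 3) *
        ((∑ i, p i * Real.exp (β * Y i)) *
          Real.log (∑ i, p i * Real.exp (Y i) + Real.exp 1 ^ 2) ^ 3) := by
  set T := ∑ i, p i * Real.exp (β * Y i) with hT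
  have hT1 : 1 ≤ T := by
    calc (1 : ℝ) = ∑ i, p i * (β * Y i + 1) := by
          simp only [mul_add, mul_one, Finset.sum_add_distrib, hp1]
          have : ∑ i, p i * (β * Y i) = β * ∑ i, p i * Y i := by
            rw [Finset.mul_sum]; exact Finset.sum_congr rfl fun i _ => by ring
          rw [this, hY]; simp
      _ ≤ T := Finset.sum_le_sum fun i _ =>
          mul_le_mul_of_nonneg_left (Real.add_one_le_exp _) (hp i)
  have hT0 : 0 < T := by linarith
  have hβ' : 0 < 1 - β := by linarith
  have htaylor : T - 1 ≤ β ^ 2 / 2 * ∑ i, p i * Y i ^ 2 +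
      β ^ 3 / 6 * ∑ i, p i * Real.exp (β * Y i) * max (Y i) 0 ^ 3 := by
    have h : T ≤ ∑ i, (p i + β * (p i * Y i) + β ^ 2 / 2 * (p i * Y i ^ 2) +
        β ^ 3 / 6 * (p i * Real.exp (β * Y i) * max (Y i) 0 ^ 3)) := by
      refine Finset.sum_le_sum fun i _ => ?_
      have h1 := mul_le_mul_of_nonneg_left (exp_le_quadratic_add (β * Y i)) (hp i)
      have h2 : max (β * Y i) 0 = β * max (Y i) 0 := by
        rw [mul_max_of_nonneg _ _ hβ.le, mul_zero]
      rw [h2] at h1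
      refine h1.trans (le_of_eq (by ring))
    simp only [Finset.sum_add_distrib, ← Finset.mul_sum, hp1, hY] at h
    linarith
  -- Jensen under the tilted distribution `p e^(βY) / T`. The exponent `1 - β` is chosen so that the
  -- tilt completes `e^((1-β)Y)` to `e^Y` in the mean.
  have hjensen := concaveOn_log_pow_three.le_map_sum (t := Finset.univ)
    (w := fun i => p i * Real.exp (β * Y i) / T)
    (p := fun i => Real.exp ((1 - β) * Y i) + Real.exp 1 ^ 2)
    (fun i _ => div_nonneg (mul_nonneg (hp i) (Real.exp_pos _).le) hT0.le)
    (by rw [← Finset.sum_div, ← hT, div_self hT0.ne'])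
    (fun i _ => by
      rw [Set.mem_Ici]
      linarith [Real.exp_pos ((1 - β) * Y i)])
  simp only [smul_eq_mul] at hjensen
  have hmean : ∑ i, p i * Real.exp (β * Y i) / T *
      (Real.exp ((1 - β) * Y i) + Real.exp 1 ^ 2) =
      (∑ i, p i * Real.exp (Y i)) / T + Real.exp 1 ^ 2 := by
    have h1 : ∀ i, p i * Real.exp (β * Y i) / T * (Real.exp ((1 - β) * Y i) + Real.exp 1 ^ 2) =
        p i * Real.exp (Y i) / T + p i * Real.exp (β * Y i) / T * Real.exp 1 ^ 2 := fun i => by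
      have : Real.exp (Y i) = Real.exp (β * Y i) * Real.exp ((1 - β) * Y i) := by
        rw [← Real.exp_add]; ring_nf
      rw [this]; ring
    rw [Finset.sum_congr rfl fun i _ => h1 i, Finset.sum_add_distrib, ← Finset.sum_mul,
      ← Finset.sum_div, ← Finset.sum_div, ← hT, div_self hT0.ne', one_mul]
  rw [hmean] at hjensen
  have hS : 0 ≤ ∑ i, p i * Real.exp (Y i) :=
    Finset.sum_nonneg fun i _ => mul_nonneg (hp i) (Real.exp_pos _).le
  have he1 : 1 ≤ Real.exp 1 ^ 2 := one_le_pow₀ (Real.one_le_exp zero_le_one)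
  -- Centring gives `T ≥ 1`, so the denominator `T` can be dropped.
  have hmono : Real.log ((∑ i, p i * Real.exp (Y i)) / T + Real.exp 1 ^ 2) ^ 3 ≤
      Real.log (∑ i, p i * Real.exp (Y i) + Real.exp 1 ^ 2) ^ 3 := by
    have hd : (∑ i, p i * Real.exp (Y i)) / T ≤ ∑ i, p i * Real.exp (Y i) := div_le_self hS hT1
    have hd0 : 0 ≤ (∑ i, p i * Real.exp (Y i)) / T := div_nonneg hS hT0.le
    exact pow_le_pow_left₀ (Real.log_nonneg (by linarith))
      (Real.log_le_log (by linarith) (by linarith)) 3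
  have hpt : (1 - β) ^ 3 * ∑ i, p i * Real.exp (β * Y i) * max (Y i) 0 ^ 3 ≤
      T * ∑ i, p i * Real.exp (β * Y i) / T *
        Real.log (Real.exp ((1 - β) * Y i) + Real.exp 1 ^ 2) ^ 3 := by
    rw [Finset.mul_sum, Finset.mul_sum]
    refine Finset.sum_le_sum fun i _ => ?_
    have hl : (1 - β) * max (Y i) 0 ≤
        Real.log (Real.exp ((1 - β) * Y i) + Real.exp 1 ^ 2) := by
      rw [mul_max_of_nonneg _ _ hβ'.le, mul_zero]
      refine max_le ?_ (Real.log_nonneg (by linarith [Real.exp_pos ((1 - β) * Y i)]))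
      rw [Real.le_log_iff_exp_le (by positivity)]
      linarith
    have hl3 := pow_le_pow_left₀ (mul_nonneg hβ'.le (le_max_right _ _)) hl 3
    have hw : 0 ≤ p i * Real.exp (β * Y i) := mul_nonneg (hp i) (Real.exp_pos _).le
    calc _ = p i * Real.exp (β * Y i) * ((1 - β) * max (Y i) 0) ^ 3 := by ring
      _ ≤ p i * Real.exp (β * Y i) *
          Real.log (Real.exp ((1 - β) * Y i) + Real.exp 1 ^ 2) ^ 3 := by gcongr
      _ = _ := by field_simp
  have hfin : (1 - β) ^ 3 * ∑ i, p i * Real.exp (β * Y i) * max (Y i) 0 ^ 3 ≤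
      T * Real.log (∑ i, p i * Real.exp (Y i) + Real.exp 1 ^ 2) ^ 3 :=
    hpt.trans (mul_le_mul_of_nonneg_left (hjensen.trans hmono) hT0.le)
  have hlog := Real.log_le_sub_one_of_pos hT0
  have hlast : β ^ 3 / 6 * ∑ i, p i * Real.exp (β * Y i) * max (Y i) 0 ^ 3 ≤
      β ^ 3 / (6 * (1 - β) ^ 3) *
        (T * Real.log (∑ i, p i * Real.exp (Y i) + Real.exp 1 ^ 2) ^ 3) := by
    calc _ = β ^ 3 / (6 * (1 - β) ^ 3) *
          ((1 - β) ^ 3 * ∑ i, p i * Real.exp (β * Y i) * max (Y i) 0 ^ 3) := by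
          field_simp
      _ ≤ _ := by gcongr
  linarith

/-! ### Spectral calculus and Hilbert-Schmidt norms. -/

variable {n : Type*} [Fintype n] [DecidableEq n]

/-- Functional calculus of a Hermitian matrix with complex-valued functions. -/
def spectralMap {M : Matrix n n ℂ} (hM : M.IsHermitian) (g : ℝ → ℂ) : Matrix n n ℂ :=
  (hM.eigenvectorUnitary : Matrix n n ℂ) * diagonal (fun i => g (hM.eigenvalues i)) *
    (hM.eigenvectorUnitary : Matrix n n ℂ)ᴴ

theorem eigenvectorUnitary_conjTranspose_mul {M : Matrix n n ℂ} (hM : M.IsHermitian) :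
    (hM.eigenvectorUnitary : Matrix n n ℂ)ᴴ * (hM.eigenvectorUnitary : Matrix n n ℂ) = 1 :=
  Unitary.star_mul_self_of_mem hM.eigenvectorUnitary.2

theorem eigenvectorUnitary_mul_conjTranspose {M : Matrix n n ℂ} (hM : M.IsHermitian) :
    (hM.eigenvectorUnitary : Matrix n n ℂ) * (hM.eigenvectorUnitary : Matrix n n ℂ)ᴴ = 1 :=
  Unitary.mul_star_self_of_mem hM.eigenvectorUnitary.2

theorem cfc_eq_spectralMap {M : Matrix n n ℂ} (hM : M.IsHermitian) (f : ℝ → ℝ) :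
    cfc f M = spectralMap hM (fun x => (f x : ℂ)) := by
  rw [hM.cfc_eq, IsHermitian.cfc, Unitary.conjStarAlgAut_apply]
  rfl

theorem spectralMap_ofReal {M : Matrix n n ℂ} (hM : M.IsHermitian) :
    spectralMap hM (fun x => (x : ℂ)) = M := by
  conv_rhs => rw [hM.spectral_theorem, Unitary.conjStarAlgAut_apply]
  rfl

theorem spectralMap_congr {M : Matrix n n ℂ} (hM : M.IsHermitian) {f g : ℝ → ℂ}
    (h : ∀ i, f (hM.eigenvalues i) = g (hM.eigenvalues i)) :
    spectralMap hM f = spectralMap hM g := by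
  simp only [spectralMap, h]

theorem spectralMap_mul {M : Matrix n n ℂ} (hM : M.IsHermitian) (f g : ℝ → ℂ) :
    spectralMap hM f * spectralMap hM g = spectralMap hM (fun x => f x * g x) := by
  simp only [spectralMap]
  rw [← diagonal_mul_diagonal]
  simp only [Matrix.mul_assoc]
  rw [← Matrix.mul_assoc _ᴴ, eigenvectorUnitary_conjTranspose_mul, Matrix.one_mul]

theorem spectralMap_one {M : Matrix n n ℂ} (hM : M.IsHermitian) :
    spectralMap hM (fun _ => 1) = 1 := by
  rw [spectralMap, diagonal_one, Matrix.mul_one, eigenvectorUnitary_mul_conjTranspose]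

theorem spectralMap_conjTranspose {M : Matrix n n ℂ} (hM : M.IsHermitian) (f : ℝ → ℂ) :
    (spectralMap hM f)ᴴ = spectralMap hM (fun x => star (f x)) := by
  simp only [spectralMap, conjTranspose_mul, conjTranspose_conjTranspose, diagonal_conjTranspose,
    Matrix.mul_assoc]
  rfl

/-- The matrix of inner products between the eigenbases of two Hermitian matrices. -/
def overlap {M N : Matrix n n ℂ} (hM : M.IsHermitian) (hN : N.IsHermitian) : Matrix n n ℂ :=
  (hM.eigenvectorUnitary : Matrix n n ℂ)ᴴ * (hN.eigenvectorUnitary : Matrix n n ℂ)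

theorem spectralMap_mul_spectralMap {M N : Matrix n n ℂ} (hM : M.IsHermitian)
    (hN : N.IsHermitian) (f g : ℝ → ℂ) :
    spectralMap hM f * spectralMap hN g = (hM.eigenvectorUnitary : Matrix n n ℂ) *
      (diagonal (fun i => f (hM.eigenvalues i)) * overlap hM hN *
        diagonal (fun i => g (hN.eigenvalues i))) * (hN.eigenvectorUnitary : Matrix n n ℂ)ᴴ := by
  simp only [spectralMap, overlap, Matrix.mul_assoc]

theorem trace_spectralMap_mul_spectralMap {M N : Matrix n n ℂ} (hM : M.IsHermitian)
    (hN : N.IsHermitian) (f g : ℝ → ℂ) :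
    (spectralMap hM f * spectralMap hN g).trace = ∑ i, ∑ j,
      f (hM.eigenvalues i) * g (hN.eigenvalues j) * ((‖overlap hM hN i j‖ ^ 2 : ℝ) : ℂ) := by
  rw [spectralMap_mul_spectralMap, trace_mul_cycle]
  have : (hN.eigenvectorUnitary : Matrix n n ℂ)ᴴ * (hM.eigenvectorUnitary : Matrix n n ℂ) =
      (overlap hM hN)ᴴ := by
    simp [overlap, conjTranspose_mul]
  rw [this, trace_mul_comm, trace]
  refine Finset.sum_congr rfl fun i _ => ?_
  rw [diag_apply, mul_apply]
  refine Finset.sum_congr rfl fun j _ => ?_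
  rw [mul_diagonal, diagonal_mul, conjTranspose_apply, Complex.ofReal_pow, ← Complex.mul_conj']
  simp only [starRingEnd_apply]
  ring

/-- Squared Hilbert-Schmidt norm. -/
def hsSq (X : Matrix n n ℂ) : ℝ := ∑ i, ∑ j, ‖X i j‖ ^ 2

theorem hsSq_nonneg (X : Matrix n n ℂ) : 0 ≤ hsSq X :=
  Finset.sum_nonneg fun _ _ => Finset.sum_nonneg fun _ _ => by positivity

theorem hsSq_conjTranspose (X : Matrix n n ℂ) : hsSq Xᴴ = hsSq X := by
  rw [hsSq, hsSq, Finset.sum_comm]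
  simp

theorem ofReal_hsSq (X : Matrix n n ℂ) : (hsSq X : ℂ) = (Xᴴ * X).trace := by
  rw [trace_mul_comm, hsSq, trace]
  push_cast
  refine Finset.sum_congr rfl fun i _ => ?_
  rw [diag_apply, mul_apply]
  refine Finset.sum_congr rfl fun j _ => ?_
  rw [conjTranspose_apply, ← Complex.mul_conj', starRingEnd_apply]

theorem norm_trace_mul_le (X Y : Matrix n n ℂ) :
    ‖(X * Y).trace‖ ≤ Real.sqrt (hsSq X) * Real.sqrt (hsSq Y) := by
  rw [← hsSq_conjTranspose Y]
  have h1 : ‖(X * Y).trace‖ ≤ ∑ x : n × n, ‖X x.1 x.2‖ * ‖Yᴴ x.1 x.2‖ := by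
    rw [trace, Fintype.sum_prod_type]
    refine (norm_sum_le _ _).trans (Finset.sum_le_sum fun i _ => ?_)
    rw [diag_apply, mul_apply]
    refine (norm_sum_le _ _).trans (Finset.sum_le_sum fun j _ => ?_)
    simp
  refine h1.trans ((Real.sum_mul_le_sqrt_mul_sqrt _ _ _).trans (le_of_eq ?_))
  simp only [hsSq, Fintype.sum_prod_type]

theorem hsSq_mul_unitary (X : Matrix n n ℂ) {U : Matrix n n ℂ} (hU : U * Uᴴ = 1) :
    hsSq (X * U) = hsSq X := by
  have : ((hsSq (X * U) : ℝ) : ℂ) = hsSq X := by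
    rw [ofReal_hsSq, ofReal_hsSq, conjTranspose_mul, trace_mul_comm]
    simp only [Matrix.mul_assoc]
    rw [← Matrix.mul_assoc U, hU, Matrix.one_mul, trace_mul_comm]
  exact_mod_cast this

/-- In the eigenbasis of `M` the right factor scales each column by a number of modulus at most one.
It will serve to discard purely imaginary powers. -/
theorem hsSq_mul_spectralMap_le (X : Matrix n n ℂ) {M : Matrix n n ℂ} (hM : M.IsHermitian)
    {g : ℝ → ℂ} (hg : ∀ i, ‖g (hM.eigenvalues i)‖ ≤ 1) :
    hsSq (X * spectralMap hM g) ≤ hsSq X := by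
  have h1 : X * spectralMap hM g = X * (hM.eigenvectorUnitary : Matrix n n ℂ) *
      diagonal (fun i => g (hM.eigenvalues i)) * (hM.eigenvectorUnitary : Matrix n n ℂ)ᴴ := by
    simp only [spectralMap, Matrix.mul_assoc]
  rw [h1, hsSq_mul_unitary _ (by
    rw [conjTranspose_conjTranspose, eigenvectorUnitary_conjTranspose_mul]),
    ← hsSq_mul_unitary X (eigenvectorUnitary_mul_conjTranspose hM)]
  refine Finset.sum_le_sum fun i _ => Finset.sum_le_sum fun j _ => ?_
  rw [mul_diagonal, norm_mul]
  exact pow_le_pow_left₀ (by positivity) (mul_le_of_le_one_right (norm_nonneg _) (hg j)) 2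

/-! ### Complex powers on supports and the three-lines theorem. -/

/-- Complex power vanishing at zero for every exponent. -/
def suppPow (z : ℂ) (x : ℝ) : ℂ := if x = 0 then 0 else (x : ℂ) ^ z

theorem suppPow_mul (z w : ℂ) (x : ℝ) : suppPow z x * suppPow w x = suppPow (z + w) x := by
  unfold suppPow
  split_ifs with h
  · simp
  · rw [Complex.cpow_add _ _ (by exact_mod_cast h)]

theorem suppPow_one (x : ℝ) : suppPow 1 x = x := by
  unfold suppPow
  split_ifs with h <;> simp [h]

theorem star_suppPow (z : ℂ) {x : ℝ} (hx : 0 ≤ x) : star (suppPow z x) = suppPow (star z) x := by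
  unfold suppPow
  split_ifs with h
  · simp
  · rw [Complex.star_def, Complex.cpow_conj _ _ (by
      rw [Complex.arg_ofReal_of_nonneg hx]; exact Real.pi_pos.ne), Complex.conj_ofReal]

theorem suppPow_ofReal (s : ℝ) {x : ℝ} (hx : 0 ≤ x) :
    suppPow s x = ((if x = 0 then 0 else x ^ s : ℝ) : ℂ) := by
  unfold suppPow
  split_ifs with h
  · simp
  · rw [Complex.ofReal_cpow hx]

theorem norm_suppPow (z : ℂ) {x : ℝ} (hx : 0 < x) : ‖suppPow z x‖ = x ^ z.re := by
  rw [suppPow, if_neg hx.ne', Complex.norm_cpow_eq_rpow_re_of_pos hx]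

theorem norm_suppPow_le_one {z : ℂ} (hz : z.re = 0) {x : ℝ} (hx : 0 ≤ x) :
    ‖suppPow z x‖ ≤ 1 := by
  rcases hx.eq_or_lt with rfl | h
  · simp [suppPow]
  · rw [norm_suppPow z h, hz, Real.rpow_zero]

theorem star_suppPow_mul (z : ℂ) {x : ℝ} (hx : 0 ≤ x) :
    star (suppPow z x) * suppPow z x = suppPow ((2 * z.re : ℝ) : ℂ) x := by
  rw [star_suppPow z hx, suppPow_mul]
  congr 1
  rw [Complex.star_def, add_comm, Complex.add_conj]

theorem mpow_eq_spectralMap {M : Matrix n n ℂ} (hM : M.PosSemidef) (s : ℝ) :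
    mpow M s = spectralMap hM.1 (suppPow s) := by
  rw [mpow, cfc_eq_spectralMap hM.1]
  exact spectralMap_congr _ fun i => (suppPow_ofReal s (hM.eigenvalues_nonneg i)).symm

theorem spectralMap_suppPow_mul {M : Matrix n n ℂ} (hM : M.IsHermitian) (z w : ℂ) :
    spectralMap hM (suppPow z) * spectralMap hM (suppPow w) =
      spectralMap hM (suppPow (z + w)) := by
  rw [spectralMap_mul]
  simp only [suppPow_mul]

theorem spectralMap_suppPow_star_mul {M : Matrix n n ℂ} (hM : M.PosSemidef) (z : ℂ) :
    (spectralMap hM.1 (suppPow z))ᴴ * spectralMap hM.1 (suppPow z) =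
      spectralMap hM.1 (suppPow ((2 * z.re : ℝ) : ℂ)) := by
  rw [spectralMap_conjTranspose, spectralMap_mul]
  exact spectralMap_congr _ fun i => star_suppPow_mul z (hM.eigenvalues_nonneg i)

theorem spectralMap_suppPow_one {M : Matrix n n ℂ} (hM : M.IsHermitian) :
    spectralMap hM (suppPow 1) = M := by
  conv_rhs => rw [← spectralMap_ofReal hM]
  exact spectralMap_congr _ fun i => suppPow_one _

/-- Entire functions that are bounded on the vertical strip `0 ≤ re z ≤ 1`. -/
def StripBounded (f : ℂ → ℂ) : Prop :=
  Differentiable ℂ f ∧ ∃ C : ℝ, ∀ z ∈ Complex.HadamardThreeLines.verticalClosedStrip 0 1, ‖f z‖ ≤ C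

theorem StripBounded.const (c : ℂ) : StripBounded fun _ => c :=
  ⟨differentiable_const c, ‖c‖, fun _ _ => le_rfl⟩

theorem StripBounded.mul {f g : ℂ → ℂ} (hf : StripBounded f) (hg : StripBounded g) :
    StripBounded fun z => f z * g z := by
  obtain ⟨C, hC⟩ := hf.2
  obtain ⟨D, hD⟩ := hg.2
  refine ⟨hf.1.mul hg.1, C * D, fun z hz => ?_⟩
  rw [norm_mul]
  exact mul_le_mul (hC z hz) (hD z hz) (norm_nonneg _) ((norm_nonneg _).trans (hC z hz))

theorem StripBounded.sum {ι : Type*} {s : Finset ι} {f : ι → ℂ → ℂ}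
    (hf : ∀ i ∈ s, StripBounded (f i)) : StripBounded fun z => ∑ i ∈ s, f i z := by
  have h2 : ∀ i, ∃ C : ℝ, i ∈ s → ∀ z ∈ Complex.HadamardThreeLines.verticalClosedStrip 0 1,
      ‖f i z‖ ≤ C := fun i => by
    by_cases hi : i ∈ s
    · obtain ⟨C, hC⟩ := (hf i hi).2
      exact ⟨C, fun _ => hC⟩
    · exact ⟨0, fun h => absurd h hi⟩
  choose C hC using h2
  refine ⟨Differentiable.fun_sum fun i hi => (hf i hi).1, ∑ i ∈ s, C i, fun z hz => ?_⟩
  exact (norm_sum_le _ _).trans (Finset.sum_le_sum fun i hi => hC i hi z hz)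

/-- The modulus depends only on `z.re`, which ranges over a compact interval. -/
theorem stripBounded_suppPow (a b : ℝ) {x : ℝ} (hx : 0 ≤ x) :
    StripBounded fun z => suppPow (a + b * z) x := by
  rcases hx.eq_or_lt with rfl | hx
  · simpa [suppPow] using StripBounded.const 0
  refine ⟨?_, ?_⟩
  · simp only [suppPow, if_neg hx.ne']
    exact Differentiable.const_cpow (by fun_prop) (Or.inl (by exact_mod_cast hx.ne'))
  · have hcont : Continuous fun t : ℝ => x ^ (a + b * t) :=
      Continuous.rpow (by fun_prop) (by fun_prop) fun _ => Or.inl hx.ne'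
    obtain ⟨C, hC⟩ := (isCompact_Icc (a := (0 : ℝ)) (b := 1)).bddAbove_image hcont.continuousOn
    refine ⟨C, fun z hz => ?_⟩
    rw [norm_suppPow _ hx]
    refine hC ⟨z.re, hz, ?_⟩
    simp

theorem stripBounded_mul_apply {F G : ℂ → Matrix n n ℂ}
    (hF : ∀ i j, StripBounded fun z => F z i j) (hG : ∀ i j, StripBounded fun z => G z i j)
    (i j : n) : StripBounded fun z => (F z * G z) i j := by
  simp only [mul_apply]
  exact StripBounded.sum fun k _ => (hF i k).mul (hG k j)

theorem stripBounded_spectralMap_apply {M : Matrix n n ℂ} (hM : M.PosSemidef) (a b : ℝ) (i j : n) :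
    StripBounded fun z => spectralMap hM.1 (suppPow (a + b * z)) i j := by
  refine stripBounded_mul_apply
    (F := fun z => (hM.1.eigenvectorUnitary : Matrix n n ℂ) *
      diagonal (fun i => suppPow (a + b * z) (hM.1.eigenvalues i)))
    (G := fun _ => (hM.1.eigenvectorUnitary : Matrix n n ℂ)ᴴ)
    (stripBounded_mul_apply (F := fun _ => (hM.1.eigenvectorUnitary : Matrix n n ℂ))
      (G := fun z => diagonal (fun i => suppPow (a + b * z) (hM.1.eigenvalues i)))
      (fun i j => StripBounded.const _) fun i j => ?_) (fun i j => StripBounded.const _) i j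
  by_cases h : i = j
  · subst h
    simp only [diagonal_apply_eq]
    exact stripBounded_suppPow a b (hM.eigenvalues_nonneg i)
  · simp only [diagonal_apply_ne _ h]
    exact StripBounded.const 0

theorem StripBounded.norm_le {f : ℂ → ℂ} (hf : StripBounded f) {a b : ℝ}
    (ha : ∀ z : ℂ, z.re = 0 → ‖f z‖ ≤ a) (hb : ∀ z : ℂ, z.re = 1 → ‖f z‖ ≤ b) {θ : ℝ}
    (h0 : 0 ≤ θ) (h1 : θ ≤ 1) : ‖f θ‖ ≤ a ^ (1 - θ) * b ^ θ := by
  obtain ⟨C, hC⟩ := hf.2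
  have := Complex.HadamardThreeLines.norm_le_interp_of_mem_verticalClosedStrip₀₁' f
    (z := (θ : ℂ)) (a := a) (b := b) ⟨by simpa using h0, by simpa using h1⟩ hf.1.diffContOnCl
    ⟨C, by rintro _ ⟨z, hz, rfl⟩; exact hC z hz⟩ (fun z hz => ha z hz) (fun z hz => hb z hz)
  simpa using this

/-! ### The Araki-Lieb-Thirring inequality. -/

theorem hsSq_spectralMap_suppPow {M : Matrix n n ℂ} (hM : M.PosSemidef) (z : ℂ) :
    (hsSq (spectralMap hM.1 (suppPow z)) : ℂ) =
      (spectralMap hM.1 (suppPow ((2 * z.re : ℝ) : ℂ))).trace := by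
  rw [ofReal_hsSq, spectralMap_suppPow_star_mul hM]

theorem hsSq_spectralMap_mul_spectralMap {M N : Matrix n n ℂ} (hM : M.PosSemidef)
    (hN : N.PosSemidef) (z w : ℂ) :
    (hsSq (spectralMap hM.1 (suppPow z) * spectralMap hN.1 (suppPow w)) : ℂ) =
      (spectralMap hM.1 (suppPow ((2 * z.re : ℝ) : ℂ)) *
        spectralMap hN.1 (suppPow ((2 * w.re : ℝ) : ℂ))).trace := by
  have h : spectralMap hN.1 (suppPow w) * (spectralMap hN.1 (suppPow w))ᴴ =
      spectralMap hN.1 (suppPow ((2 * w.re : ℝ) : ℂ)) := by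
    rw [← spectralMap_suppPow_star_mul hN, spectralMap_conjTranspose, spectralMap_mul, spectralMap_mul]
    simp only [mul_comm]
  rw [ofReal_hsSq, conjTranspose_mul, Matrix.mul_assoc, trace_mul_comm, Matrix.mul_assoc,
    Matrix.mul_assoc, h, ← Matrix.mul_assoc, spectralMap_suppPow_star_mul hM]

/-- Under the Hilbert-Schmidt norm, `Xᴴ` acts as half a power of `M`, since `Xᴴ * X = M`. -/
theorem hsSq_spectralMap_mul_conjTranspose {X M : Matrix n n ℂ} (hM : M.PosSemidef)
    (hX : Xᴴ * X = M) (z : ℂ) :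
    (hsSq (spectralMap hM.1 (suppPow z) * Xᴴ) : ℂ) =
      (spectralMap hM.1 (suppPow ((2 * z.re + 1 : ℝ) : ℂ))).trace := by
  rw [ofReal_hsSq, conjTranspose_mul, conjTranspose_conjTranspose, Matrix.mul_assoc, trace_mul_comm,
    Matrix.mul_assoc, Matrix.mul_assoc, hX, ← Matrix.mul_assoc, spectralMap_suppPow_star_mul hM]
  have h : spectralMap hM.1 (suppPow ((2 * z.re : ℝ) : ℂ)) * spectralMap hM.1 (suppPow 1) =
      spectralMap hM.1 (suppPow ((2 * z.re + 1 : ℝ) : ℂ)) := by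
    rw [spectralMap_suppPow_mul]
    push_cast
    rfl
  rw [← h, spectralMap_suppPow_one]

/-- The hypothesis says `T ≤ √(T P)` after division by a power of `T`. Arguing by contradiction
makes `T` positive and avoids treating `T = 0` apart. -/
theorem le_of_le_rpow_mul_rpow {T P θ : ℝ} (hT : 0 ≤ T) (hP : 0 ≤ P) (hθ : 0 < θ)
    (h : T ≤ T ^ (1 - θ) * (Real.sqrt T * Real.sqrt P) ^ θ) : T ≤ P := by
  by_contra! hlt
  have hT0 : 0 < T := lt_of_le_of_lt hP hlt
  have h1 : Real.sqrt T * Real.sqrt P < T := by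
    calc Real.sqrt T * Real.sqrt P < Real.sqrt T * Real.sqrt T :=
          mul_lt_mul_of_pos_left (Real.sqrt_lt_sqrt hP hlt) (Real.sqrt_pos.2 hT0)
      _ = T := Real.mul_self_sqrt hT
  have h2 : T ^ (1 - θ) * (Real.sqrt T * Real.sqrt P) ^ θ < T ^ (1 - θ) * T ^ θ :=
    mul_lt_mul_of_pos_left (Real.rpow_lt_rpow (by positivity) h1 hθ) (Real.rpow_pos_of_pos hT0 _)
  rw [← Real.rpow_add hT0] at h2
  simp only [sub_add_cancel, Real.rpow_one] at h2
  linarith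

/-- The Araki-Lieb-Thirring inequality, for `M = Xᴴ * X` with `X = ρ ^ (1/2) * σ ^ (-(α-1)/(2α))`. -/
theorem trace_pow_le_trace_pow_mul_pow {ρ σ X M : Matrix n n ℂ} (hρ : ρ.PosSemidef)
    (hσ : σ.PosSemidef) (hM : M.PosSemidef) (hXM : Xᴴ * X = M) {α : ℝ} (hα : 1 < α)
    (hX : X = spectralMap hρ.1 (suppPow ((1 / 2 : ℝ) : ℂ)) *
      spectralMap hσ.1 (suppPow ((-((α - 1) / α) / 2 : ℝ) : ℂ))) :
    (spectralMap hM.1 (suppPow (α : ℂ))).trace.re ≤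
      (spectralMap hρ.1 (suppPow (α : ℂ)) *
        spectralMap hσ.1 (suppPow ((1 - α : ℝ) : ℂ))).trace.re := by
  have hα0 : 0 < α := by linarith
  set T := (spectralMap hM.1 (suppPow (α : ℂ))).trace.re
  set P := (spectralMap hρ.1 (suppPow (α : ℂ)) *
        spectralMap hσ.1 (suppPow ((1 - α : ℝ) : ℂ))).trace.re
  -- At `z = 1/α` the last two factors multiply to `X`, and the trace is `tr[M^(α-1) Xᴴ X] = T`. On
  -- `re z = 0` the powers of `ρ` and `σ` are imaginary, hence contractions; on `re z = 1` their
  -- product has squared norm `P`.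
  set f : ℂ → ℂ := fun z =>
    ((spectralMap hM.1 (suppPow ((α - 1 / 2 : ℝ) + (-(α / 2) : ℝ) * z)) * Xᴴ) *
      (spectralMap hρ.1 (suppPow ((0 : ℝ) + (α / 2 : ℝ) * z)) *
        spectralMap hσ.1 (suppPow ((0 : ℝ) + (-(α - 1) / 2 : ℝ) * z)))).trace with hf
  have hfb : StripBounded f := by
    simp only [hf, trace, diag_apply]
    refine StripBounded.sum fun i _ => stripBounded_mul_apply
      (F := fun z => spectralMap hM.1 (suppPow ((α - 1 / 2 : ℝ) + (-(α / 2) : ℝ) * z)) * Xᴴ)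
      (G := fun z => spectralMap hρ.1 (suppPow ((0 : ℝ) + (α / 2 : ℝ) * z)) *
        spectralMap hσ.1 (suppPow ((0 : ℝ) + (-(α - 1) / 2 : ℝ) * z))) ?_ ?_ i i
    · exact stripBounded_mul_apply
        (F := fun z => spectralMap hM.1 (suppPow ((α - 1 / 2 : ℝ) + (-(α / 2) : ℝ) * z)))
        (stripBounded_spectralMap_apply hM _ _) (fun i j => StripBounded.const _)
    · exact stripBounded_mul_apply
        (F := fun z => spectralMap hρ.1 (suppPow ((0 : ℝ) + (α / 2 : ℝ) * z)))
        (G := fun z => spectralMap hσ.1 (suppPow ((0 : ℝ) + (-(α - 1) / 2 : ℝ) * z)))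
        (stripBounded_spectralMap_apply hρ _ _) (stripBounded_spectralMap_apply hσ _ _)
  have hTm : ∀ z : ℂ, 2 * z.re = α → hsSq (spectralMap hM.1 (suppPow z)) = T := fun z hz => by
    have := hsSq_spectralMap_suppPow hM z
    rw [hz] at this
    exact congrArg Complex.re this
  have hTX : ∀ z : ℂ, 2 * z.re + 1 = α → hsSq (spectralMap hM.1 (suppPow z) * Xᴴ) = T :=
    fun z hz => by
      have := hsSq_spectralMap_mul_conjTranspose hM hXM z
      rw [hz] at this
      exact congrArg Complex.re this
  have hPz : ∀ z w : ℂ, 2 * z.re = α → 2 * w.re = 1 - α →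
      hsSq (spectralMap hρ.1 (suppPow z) * spectralMap hσ.1 (suppPow w)) = P := fun z w hz hw => by
    have := hsSq_spectralMap_mul_spectralMap hρ hσ z w
    rw [hz, hw] at this
    exact congrArg Complex.re this
  have hT : 0 ≤ T := by
    rw [← hTm ((α / 2 : ℝ) : ℂ) (by rw [Complex.ofReal_re]; ring)]
    exact hsSq_nonneg _
  have hP : 0 ≤ P := by
    rw [← hPz ((α / 2 : ℝ) : ℂ) (((1 - α) / 2 : ℝ) : ℂ) (by rw [Complex.ofReal_re]; ring)
      (by rw [Complex.ofReal_re]; ring)]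
    exact hsSq_nonneg _
  have h0 : ∀ z : ℂ, z.re = 0 → ‖f z‖ ≤ T := fun z hz => by
    -- Splitting off `M^(α/2)` leaves two factors of squared norm at most `T`, so Cauchy-Schwarz
    -- gives `T`.
    have hsplit : spectralMap hM.1 (suppPow ((α - 1 / 2 : ℝ) + (-(α / 2) : ℝ) * z)) =
        spectralMap hM.1 (suppPow ((α / 2 : ℝ) : ℂ)) *
          spectralMap hM.1 (suppPow (((α - 1) / 2 : ℝ) + (-(α / 2) : ℝ) * z)) := by
      rw [spectralMap_suppPow_mul]
      congr 2
      push_cast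
      ring
    simp only [hf]
    rw [hsplit, Matrix.mul_assoc, Matrix.mul_assoc]
    refine (norm_trace_mul_le _ _).trans ?_
    rw [hTm _ (by rw [Complex.ofReal_re]; ring), ← Matrix.mul_assoc, ← Matrix.mul_assoc]
    have hle : hsSq (spectralMap hM.1 (suppPow (((α - 1) / 2 : ℝ) + (-(α / 2) : ℝ) * z)) * Xᴴ *
        spectralMap hρ.1 (suppPow ((0 : ℝ) + (α / 2 : ℝ) * z)) *
        spectralMap hσ.1 (suppPow ((0 : ℝ) + (-(α - 1) / 2 : ℝ) * z))) ≤ T := by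
      rw [← hTX (((α - 1) / 2 : ℝ) + (-(α / 2) : ℝ) * z)
        (by simp only [Complex.add_re, Complex.ofReal_re, Complex.re_ofReal_mul, hz]; ring)]
      refine (hsSq_mul_spectralMap_le _ _ fun i =>
        norm_suppPow_le_one ?_ (hσ.eigenvalues_nonneg i)).trans
        (hsSq_mul_spectralMap_le _ _ fun i => norm_suppPow_le_one ?_ (hρ.eigenvalues_nonneg i))
      · simp only [Complex.add_re, Complex.ofReal_re, Complex.re_ofReal_mul, hz]; ring
      · simp only [Complex.add_re, Complex.ofReal_re, Complex.re_ofReal_mul, hz]; ring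
    calc _ ≤ Real.sqrt T * Real.sqrt T := by gcongr
      _ = T := Real.mul_self_sqrt hT
  have h1 : ∀ z : ℂ, z.re = 1 → ‖f z‖ ≤ Real.sqrt T * Real.sqrt P := fun z hz => by
    refine (norm_trace_mul_le _ _).trans (le_of_eq ?_)
    rw [hTX _ (by simp only [Complex.add_re, Complex.ofReal_re, Complex.re_ofReal_mul, hz]; ring),
      hPz _ _ (by simp only [Complex.add_re, Complex.ofReal_re, Complex.re_ofReal_mul, hz]; ring)
        (by simp only [Complex.add_re, Complex.ofReal_re, Complex.re_ofReal_mul, hz]; ring)]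
  have hθ : f ((1 / α : ℝ) : ℂ) = (spectralMap hM.1 (suppPow (α : ℂ))).trace := by
    have e1 : ((α - 1 / 2 : ℝ) : ℂ) + (-(α / 2) : ℝ) * ((1 / α : ℝ) : ℂ) = ((α - 1 : ℝ) : ℂ) := by
      rw [← Complex.ofReal_mul, ← Complex.ofReal_add]
      congr 1
      field_simp
      ring
    have e2 : ((0 : ℝ) : ℂ) + (α / 2 : ℝ) * ((1 / α : ℝ) : ℂ) = ((1 / 2 : ℝ) : ℂ) := by
      rw [← Complex.ofReal_mul, ← Complex.ofReal_add]
      congr 1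
      field_simp
      ring
    have e3 : ((0 : ℝ) : ℂ) + (-(α - 1) / 2 : ℝ) * ((1 / α : ℝ) : ℂ) =
        ((-((α - 1) / α) / 2 : ℝ) : ℂ) := by
      rw [← Complex.ofReal_mul, ← Complex.ofReal_add]
      congr 1
      field_simp
      ring
    have e4 : spectralMap hM.1 (suppPow ((α - 1 : ℝ) : ℂ)) * spectralMap hM.1 (suppPow 1) =
        spectralMap hM.1 (suppPow (α : ℂ)) := by
      rw [spectralMap_suppPow_mul]
      congr 2
      push_cast
      ring
    simp only [hf]
    rw [e1, e2, e3, ← hX, Matrix.mul_assoc, hXM, ← e4, spectralMap_suppPow_one]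
  have hbound := hfb.norm_le h0 h1 (θ := 1 / α) (by positivity)
    ((div_le_one hα0).2 hα.le)
  rw [hθ] at hbound
  exact le_of_le_rpow_mul_rpow hT hP (by positivity)
    ((Complex.re_le_norm _).trans hbound)

theorem sandwiched_eq_conjTranspose_mul {ρ σ : Matrix n n ℂ} (hρ : ρ.PosSemidef)
    (hσ : σ.PosSemidef) (s : ℝ) :
    mpow σ s * ρ * mpow σ s = (spectralMap hρ.1 (suppPow ((1 / 2 : ℝ) : ℂ)) *
      spectralMap hσ.1 (suppPow (s : ℂ)))ᴴ * (spectralMap hρ.1 (suppPow ((1 / 2 : ℝ) : ℂ)) *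
      spectralMap hσ.1 (suppPow (s : ℂ))) := by
  have h1 : (spectralMap hσ.1 (suppPow (s : ℂ)))ᴴ = spectralMap hσ.1 (suppPow (s : ℂ)) := by
    rw [spectralMap_conjTranspose]
    refine spectralMap_congr _ fun i => ?_
    exact (star_suppPow _ (hσ.eigenvalues_nonneg i)).trans
      (congrArg (suppPow · _) (Complex.conj_ofReal s))
  rw [mpow_eq_spectralMap hσ, conjTranspose_mul, h1, Matrix.mul_assoc, Matrix.mul_assoc]
  congr 1
  rw [← Matrix.mul_assoc, spectralMap_suppPow_star_mul hρ]
  have h2 : ((2 * ((1 / 2 : ℝ) : ℂ).re : ℝ) : ℂ) = 1 := by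
    rw [Complex.ofReal_re]; norm_num
  rw [h2, spectralMap_suppPow_one]

/-- The sandwiched Rényi trace is at most the Petz one for orders above one. -/
theorem sandwichedTrace_le_petzTrace {ρ σ : Matrix n n ℂ} (hρ : ρ.PosSemidef) (hσ : σ.PosSemidef)
    {α : ℝ} (hα : 1 < α) : sandwichedTrace α ρ σ ≤ petzTrace α ρ σ := by
  have hM := posSemidef_conjTranspose_mul_self (spectralMap hρ.1 (suppPow ((1 / 2 : ℝ) : ℂ)) *
    spectralMap hσ.1 (suppPow ((-((α - 1) / α) / 2 : ℝ) : ℂ)))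
  rw [sandwichedTrace, petzTrace, sandwiched_eq_conjTranspose_mul hρ hσ, mpow_eq_spectralMap hM,
    mpow_eq_spectralMap hρ, mpow_eq_spectralMap hσ]
  exact trace_pow_le_trace_pow_mul_pow hρ hσ hM rfl hα rfl

/-! ### The classical joint distribution of two eigenbases. -/

theorem trace_spectralMap_mul_spectralMap_re {M N : Matrix n n ℂ} (hM : M.IsHermitian)
    (hN : N.IsHermitian) (f g : ℝ → ℝ) :
    (spectralMap hM (fun x => (f x : ℂ)) * spectralMap hN (fun x => (g x : ℂ))).trace.re =
      ∑ i, ∑ j, f (hM.eigenvalues i) * g (hN.eigenvalues j) * ‖overlap hM hN i j‖ ^ 2 := by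
  rw [trace_spectralMap_mul_spectralMap]
  simp only [← Complex.ofReal_mul, ← Complex.ofReal_sum, Complex.ofReal_re]

/-- The joint weights `λ_i |⟨i|j⟩|²` of the eigenbases of `ρ` and `σ`. -/
def jointWeight {ρ σ : Matrix n n ℂ} (hρ : ρ.IsHermitian) (hσ : σ.IsHermitian) (k : n × n) : ℝ :=
  hρ.eigenvalues k.1 * ‖overlap hρ hσ k.1 k.2‖ ^ 2

theorem jointWeight_nonneg {ρ σ : Matrix n n ℂ} (hρ : ρ.PosSemidef) (hσ : σ.IsHermitian)
    (k : n × n) : 0 ≤ jointWeight hρ.1 hσ k :=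
  mul_nonneg (hρ.eigenvalues_nonneg _) (by positivity)

theorem spectralMap_mul_self_left {M : Matrix n n ℂ} (hM : M.IsHermitian) (f : ℝ → ℝ) :
    M * spectralMap hM (fun x => (f x : ℂ)) = spectralMap hM (fun x => ((x * f x : ℝ) : ℂ)) := by
  have h := spectralMap_mul hM (fun x => (x : ℂ)) (fun x => (f x : ℂ))
  rw [spectralMap_ofReal] at h
  simpa using h

theorem spectralMap_ofReal_mul {M : Matrix n n ℂ} (hM : M.IsHermitian) (f g : ℝ → ℝ) :
    spectralMap hM (fun x => (f x : ℂ)) * spectralMap hM (fun x => (g x : ℂ)) =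
      spectralMap hM (fun x => ((f x * g x : ℝ) : ℂ)) := by
  rw [spectralMap_mul]
  simp only [Complex.ofReal_mul]

/-- The mixed second moments of functions of `ρ` and `σ` are classical moments of the joint
weights. -/
theorem trace_mul_spectralMap_mul_spectralMap_re {ρ σ : Matrix n n ℂ} (hρ : ρ.IsHermitian)
    (hσ : σ.IsHermitian) (f g : ℝ → ℝ) :
    (ρ * spectralMap hρ (fun x => (f x : ℂ)) * spectralMap hσ (fun x => (g x : ℂ))).trace.re =
      ∑ k, jointWeight hρ hσ k * (f (hρ.eigenvalues k.1) * g (hσ.eigenvalues k.2)) := by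
  rw [spectralMap_mul_self_left, trace_spectralMap_mul_spectralMap_re, Fintype.sum_prod_type]
  refine Finset.sum_congr rfl fun i _ => Finset.sum_congr rfl fun j _ => ?_
  rw [jointWeight]
  ring

theorem sum_jointWeight {ρ σ : Matrix n n ℂ} (hρ : ρ.IsHermitian) (hσ : σ.IsHermitian) :
    ∑ k, jointWeight hρ hσ k = ρ.trace.re := by
  have h := trace_mul_spectralMap_mul_spectralMap_re hρ hσ (fun _ => 1) (fun _ => 1)
  simp only [Complex.ofReal_one, spectralMap_one, mul_one] at h
  exact h.symm

/-- Logarithm of the ratio of the eigenvalues of `ρ` and `σ`, in base two. -/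
def logRatio {ρ σ : Matrix n n ℂ} (hρ : ρ.IsHermitian) (hσ : σ.IsHermitian) (k : n × n) : ℝ :=
  Real.logb 2 (hρ.eigenvalues k.1) - Real.logb 2 (hσ.eigenvalues k.2)

theorem trace_mul_mlog_sub_mlog {ρ σ : Matrix n n ℂ} (hρ : ρ.IsHermitian) (hσ : σ.IsHermitian) :
    (ρ * (mlog ρ - mlog σ)).trace.re =
      ∑ k, jointWeight hρ hσ k * logRatio hρ hσ k := by
  have h1 := trace_mul_spectralMap_mul_spectralMap_re hρ hσ (Real.logb 2) (fun _ => 1)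
  have h2 := trace_mul_spectralMap_mul_spectralMap_re hρ hσ (fun _ => 1) (Real.logb 2)
  simp only [Complex.ofReal_one, spectralMap_one, mul_one, one_mul] at h1 h2
  rw [mlog, mlog, cfc_eq_spectralMap hρ, cfc_eq_spectralMap hσ, Matrix.mul_sub, trace_sub,
    Complex.sub_re, h1, h2, ← Finset.sum_sub_distrib]
  refine Finset.sum_congr rfl fun k _ => ?_
  rw [logRatio]
  ring

theorem spectralMap_sub_const {M : Matrix n n ℂ} (hM : M.IsHermitian) (f : ℝ → ℂ) (c : ℂ) :
    spectralMap hM (fun x => f x - c) = spectralMap hM f - c • (1 : Matrix n n ℂ) := by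
  rw [← spectralMap_one hM]
  simp only [spectralMap]
  rw [← Matrix.smul_mul, ← Matrix.mul_smul, ← Matrix.sub_mul, ← Matrix.mul_sub,
    ← diagonal_smul, diagonal_sub]
  simp

/-- Although `log ρ` and `log σ` need not commute, only second-order products occur: since `ρ`
commutes with `log ρ`, cyclicity gives both cross terms the same trace. The constant `d` is absorbed
into `log ρ`. -/
theorem trace_mul_sq_mlog_sub_mlog {ρ σ : Matrix n n ℂ} (hρ : ρ.IsHermitian) (hσ : σ.IsHermitian)
    (d : ℝ) :
    (ρ * (mlog ρ - mlog σ - (d : ℂ) • (1 : Matrix n n ℂ)) ^ 2).trace.re =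
      ∑ k, jointWeight hρ hσ k * (logRatio hρ hσ k - d) ^ 2 := by
  set f : ℝ → ℝ := fun x => Real.logb 2 x - d with hf
  have hL : mlog ρ - (d : ℂ) • (1 : Matrix n n ℂ) = spectralMap hρ (fun x => (f x : ℂ)) := by
    rw [mlog, cfc_eq_spectralMap hρ, ← spectralMap_sub_const]
    simp only [hf, Complex.ofReal_sub]
  have hS : mlog σ = spectralMap hσ (fun x => (Real.logb 2 x : ℂ)) := cfc_eq_spectralMap hσ _
  set L := spectralMap hρ (fun x => (f x : ℂ)) with hLdef
  set S := spectralMap hσ (fun x => (Real.logb 2 x : ℂ)) with hSdef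
  have hcomm : ρ * L = L * ρ := by
    have e1 := spectralMap_mul hρ (fun x => (x : ℂ)) (fun x => (f x : ℂ))
    have e2 := spectralMap_mul hρ (fun x => (f x : ℂ)) (fun x => (x : ℂ))
    rw [spectralMap_ofReal] at e1 e2
    rw [hLdef, e1, e2]
    simp only [mul_comm]
  have hLL : L * L = spectralMap hρ (fun x => ((f x * f x : ℝ) : ℂ)) := spectralMap_ofReal_mul _ _ _
  have hSS : S * S = spectralMap hσ (fun x => ((Real.logb 2 x * Real.logb 2 x : ℝ) : ℂ)) :=
    spectralMap_ofReal_mul _ _ _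
  have h1 := trace_mul_spectralMap_mul_spectralMap_re hρ hσ (fun x => f x * f x) (fun _ => 1)
  have h2 := trace_mul_spectralMap_mul_spectralMap_re hρ hσ f (Real.logb 2)
  have h3 := trace_mul_spectralMap_mul_spectralMap_re hρ hσ (fun _ => 1)
    (fun x => Real.logb 2 x * Real.logb 2 x)
  rw [← hLL] at h1
  rw [← hSS] at h3
  simp only [Complex.ofReal_one, spectralMap_one, mul_one, one_mul] at h1 h3
  have hSL : (ρ * (S * L)).trace = (ρ * L * S).trace := by
    rw [← Matrix.mul_assoc, trace_mul_cycle, ← hcomm]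
  have hexp : ρ * (mlog ρ - mlog σ - (d : ℂ) • (1 : Matrix n n ℂ)) ^ 2 =
      ρ * (L * L) - ρ * L * S - ρ * (S * L) + ρ * (S * S) := by
    rw [sub_right_comm, hL, hS]
    noncomm_ring
  rw [hexp, trace_add, trace_sub, trace_sub, hSL, Complex.add_re, Complex.sub_re, Complex.sub_re,
    h1, h2, h3, ← Finset.sum_sub_distrib, ← Finset.sum_sub_distrib, ← Finset.sum_add_distrib]
  refine Finset.sum_congr rfl fun k _ => ?_
  simp only [hf, logRatio]
  ring

/-- `ρ` annihilates the kernel projector `g(σ)`, so `tr[ρ g(σ)] = 0`; this trace is a sum of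
nonnegative terms, which all vanish. -/
theorem jointWeight_eq_zero {ρ σ : Matrix n n ℂ} (hρ : ρ.PosSemidef) (hσ : σ.PosSemidef)
    (hker : ∀ v, σ *ᵥ v = 0 → ρ *ᵥ v = 0) {k : n × n} (hk : hσ.1.eigenvalues k.2 = 0) :
    jointWeight hρ.1 hσ.1 k = 0 := by
  set g : ℝ → ℝ := fun x => if x = 0 then 1 else 0 with hg
  have h0 : σ * spectralMap hσ.1 (fun x => (g x : ℂ)) = 0 := by
    rw [spectralMap_mul_self_left]
    have : ∀ x : ℝ, x * g x = 0 := fun x => by simp only [hg]; split_ifs with h <;> simp [h]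
    simp [this, spectralMap]
  have h1 : ρ * spectralMap hσ.1 (fun x => (g x : ℂ)) = 0 := by
    ext i j
    have h2 := hker (fun i => spectralMap hσ.1 (fun x => (g x : ℂ)) i j)
      (by ext i; exact congrFun (congrFun h0 i) j)
    exact congrFun h2 i
  have h2 := trace_mul_spectralMap_mul_spectralMap_re hρ.1 hσ.1 (fun _ => 1) g
  simp only [Complex.ofReal_one, spectralMap_one, Matrix.mul_one, one_mul, h1, trace_zero,
    Complex.zero_re] at h2
  have hg0 : ∀ x, 0 ≤ g x := fun x => by simp only [hg]; split_ifs <;> norm_num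
  have h3 := (Finset.sum_eq_zero_iff_of_nonneg fun k _ =>
    mul_nonneg (jointWeight_nonneg hρ hσ.1 k) (hg0 (hσ.1.eigenvalues k.2))).1 h2.symm k
      (Finset.mem_univ k)
  simpa [hg, hk] using h3

/-- On positive eigenvalues, `λ^α μ^(1-α) = λ e^((α-1)(ln λ - ln μ))`. At a zero eigenvalue the
exponential does not vanish as the generalized power does, but the weight is zero there, for `σ` by
the kernel inclusion. -/
theorem petzTrace_eq_sum {ρ σ : Matrix n n ℂ} (hρ : ρ.PosSemidef) (hσ : σ.PosSemidef)
    (hker : ∀ v, σ *ᵥ v = 0 → ρ *ᵥ v = 0) (α : ℝ) :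
    petzTrace α ρ σ = ∑ k, jointWeight hρ.1 hσ.1 k *
      Real.exp ((α - 1) * (Real.log 2 * logRatio hρ.1 hσ.1 k)) := by
  rw [petzTrace, mpow, mpow, cfc_eq_spectralMap hρ.1, cfc_eq_spectralMap hσ.1,
    trace_spectralMap_mul_spectralMap_re, Fintype.sum_prod_type]
  refine Finset.sum_congr rfl fun i _ => Finset.sum_congr rfl fun j _ => ?_
  have hl2 : Real.log 2 ≠ 0 := (Real.log_pos one_lt_two).ne'
  rcases (hρ.eigenvalues_nonneg i).eq_or_lt with hi | hi
  · simp [jointWeight, ← hi]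
  rcases (hσ.eigenvalues_nonneg j).eq_or_lt with hj | hj
  · rw [jointWeight_eq_zero hρ hσ hker (k := (i, j)) hj.symm, ← hj]
    simp
  have he : Real.log 2 * logRatio hρ.1 hσ.1 (i, j) =
      Real.log (hρ.1.eigenvalues i) - Real.log (hσ.1.eigenvalues j) := by
    simp only [logRatio, Real.logb]
    field_simp
  have h1 : hρ.1.eigenvalues i ^ α * hσ.1.eigenvalues j ^ (1 - α) = hρ.1.eigenvalues i *
      Real.exp ((α - 1) * (Real.log 2 * logRatio hρ.1 hσ.1 (i, j))) := by
    rw [he]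
    conv_rhs => rw [← Real.exp_log hi]
    rw [Real.rpow_def_of_pos hi, Real.rpow_def_of_pos hj, ← Real.exp_add, Real.log_exp,
      ← Real.exp_add]
    ring_nf
  rw [if_neg hi.ne', if_neg hj.ne', h1, jointWeight]
  ring

/-! ### Positivity of the sandwiched trace and the second-order bound. -/

theorem eq_zero_of_hsSq_eq_zero {X : Matrix n n ℂ} (h : hsSq X = 0) : X = 0 := by
  ext i j
  have h1 := (Finset.sum_eq_zero_iff_of_nonneg fun i _ =>
    Finset.sum_nonneg fun j _ => by positivity).1 h i (Finset.mem_univ i)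
  have h2 := (Finset.sum_eq_zero_iff_of_nonneg fun j _ => by positivity).1 h1 j (Finset.mem_univ j)
  simpa using h2

/-- If the trace vanished, so would `M^(α/2)`, then `M = Xᴴ X`, then `X`, then `tr[ρ σ^(2s)]`. Every
joint weight would be zero, against their sum `tr ρ = 1`. Positivity is needed for the monotonicity
of the logarithm and for inverting `Real.logb`. -/
theorem sandwichedTrace_pos {ρ σ : Matrix n n ℂ} (hρ : IsDensity ρ) (hσ : σ.PosSemidef)
    (hker : ∀ v, σ *ᵥ v = 0 → ρ *ᵥ v = 0) (α : ℝ) : 0 < sandwichedTrace α ρ σ := by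
  set s : ℝ := -((α - 1) / α) / 2
  set X := spectralMap hρ.1.1 (suppPow ((1 / 2 : ℝ) : ℂ)) * spectralMap hσ.1 (suppPow (s : ℂ))
    with hX
  have hM := posSemidef_conjTranspose_mul_self X
  have hT : sandwichedTrace α ρ σ = hsSq (spectralMap hM.1 (suppPow ((α / 2 : ℝ) : ℂ))) := by
    have h := hsSq_spectralMap_suppPow hM ((α / 2 : ℝ) : ℂ)
    rw [Complex.ofReal_re, mul_div_cancel₀ _ two_ne_zero] at h
    rw [sandwichedTrace, sandwiched_eq_conjTranspose_mul hρ.1 hσ, mpow_eq_spectralMap hM, ← h,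
      Complex.ofReal_re]
  rw [hT]
  refine (hsSq_nonneg _).lt_of_ne' fun h0 => ?_
  have hM0 : Xᴴ * X = 0 := by
    have h := spectralMap_suppPow_mul hM.1 ((α / 2 : ℝ) : ℂ) (1 - (α / 2 : ℝ))
    rw [eq_zero_of_hsSq_eq_zero h0, Matrix.zero_mul, add_sub_cancel,
      spectralMap_suppPow_one] at h
    exact h.symm
  have hX0 : hsSq X = 0 := by
    have h := ofReal_hsSq X
    rw [hM0, trace_zero] at h
    exact_mod_cast h
  have hW : ∀ k, jointWeight hρ.1.1 hσ.1 k = 0 := fun k => by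
    have h := hsSq_spectralMap_mul_spectralMap hρ.1 hσ ((1 / 2 : ℝ) : ℂ) (s : ℂ)
    have h2 : ((2 * ((1 / 2 : ℝ) : ℂ).re : ℝ) : ℂ) = 1 := by
      rw [Complex.ofReal_re]; norm_num
    rw [← hX, hX0, h2, spectralMap_suppPow_one] at h
    rw [spectralMap_congr hσ.1 (g := fun x =>
      ((if x = 0 then 0 else x ^ (2 * (s : ℂ).re) : ℝ) : ℂ))
      fun i => suppPow_ofReal _ (hσ.eigenvalues_nonneg i)] at h
    have h3 := trace_mul_spectralMap_mul_spectralMap_re hρ.1.1 hσ.1 (fun _ => 1)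
      (fun x => if x = 0 then 0 else x ^ (2 * (s : ℂ).re))
    simp only [Complex.ofReal_one, spectralMap_one, Matrix.mul_one, one_mul, ← h,
      Complex.ofReal_zero, Complex.zero_re] at h3
    have h4 := (Finset.sum_eq_zero_iff_of_nonneg fun k _ =>
      mul_nonneg (jointWeight_nonneg hρ.1 hσ.1 k) (by
        split_ifs
        · exact le_rfl
        · exact Real.rpow_nonneg (hσ.eigenvalues_nonneg _) _)).1 h3.symm k (Finset.mem_univ k)
    rcases (hσ.eigenvalues_nonneg k.2).eq_or_lt with hk | hk
    · exact jointWeight_eq_zero hρ.1 hσ hker hk.symm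
    · rw [if_neg hk.ne'] at h4
      exact (mul_eq_zero.1 h4).resolve_right (Real.rpow_pos_of_pos hk _).ne'
  have h1 := sum_jointWeight hρ.1.1 hσ.1
  simp [hW, hρ.2] at h1

theorem supp_le_supp {ρ σ : Matrix n n ℂ} (hker : ∀ v, σ *ᵥ v = 0 → ρ *ᵥ v = 0) :
    supp ρ ≤ supp σ := by
  refine Submodule.orthogonal_le fun v hv => ?_
  rw [LinearMap.mem_ker, toLpLin_apply] at hv ⊢
  have h := hker v.ofLp (by simpa using hv)
  simp [h]

/-- Second-order expansion of the sandwiched Rényi divergence about order one. -/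
theorem sandwiched_second_order {ρ σ : Matrix n n ℂ} (hρ : IsDensity ρ) (hσ : σ.PosSemidef)
    (hker : ∀ v, σ *ᵥ v = 0 → ρ *ᵥ v = 0) {α : ℝ} (h1 : 1 < α) (h2 : α < 2) {D Dpetz Dtwo : ℝ}
    (hD : D = (ρ * (mlog ρ - mlog σ)).trace.re)
    (hDpetz : Dpetz = 1 / (α - 1) * Real.logb 2 (petzTrace α ρ σ))
    (hDtwo : Dtwo = Real.logb 2 (petzTrace 2 ρ σ)) :
    1 / (α - 1) * Real.logb 2 (sandwichedTrace α ρ σ) ≤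
      D + (α - 1) * Real.log 2 / 2 *
        (ρ * (mlog ρ - mlog σ - (D : ℂ) • (1 : Matrix n n ℂ)) ^ 2).trace.re +
      (α - 1) ^ 2 * (1 / (6 * (2 - α) ^ 3 * Real.log 2) * (2 : ℝ) ^ ((α - 1) * (Dpetz - D)) *
        Real.log ((2 : ℝ) ^ (Dtwo - D) + Real.exp 1 ^ 2) ^ 3) := by
  have hl : 0 < Real.log 2 := Real.log_pos one_lt_two
  have hβ : 0 < α - 1 := by linarith
  have hSpos := sandwichedTrace_pos hρ hσ hker α
  have hle := sandwichedTrace_le_petzTrace hρ.1 hσ h1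
  have hPpos : 0 < petzTrace α ρ σ := hSpos.trans_le hle
  have hP2pos : 0 < petzTrace 2 ρ σ := (sandwichedTrace_pos hρ hσ hker 2).trans_le
    (sandwichedTrace_le_petzTrace hρ.1 hσ one_lt_two)
  set p := jointWeight hρ.1.1 hσ.1
  set r := logRatio hρ.1.1 hσ.1
  have hp1 : ∑ k, p k = 1 := by rw [sum_jointWeight, hρ.2, Complex.one_re]
  have hDsum : D = ∑ k, p k * r k := hD.trans (trace_mul_mlog_sub_mlog _ _)
  -- Used at `γ = α` for `T` and at `γ = 2` for `E[e^Y]`.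
  have hexp : ∀ γ : ℝ, ∑ k, p k * Real.exp ((γ - 1) * (Real.log 2 * (r k - D))) =
      petzTrace γ ρ σ * (2 : ℝ) ^ (-((γ - 1) * D)) := fun γ => by
    rw [petzTrace_eq_sum hρ.1 hσ hker, Finset.sum_mul, Real.rpow_def_of_pos two_pos]
    refine Finset.sum_congr rfl fun k _ => ?_
    rw [mul_assoc, ← Real.exp_add]
    refine congrArg (fun t => p k * Real.exp t) ?_
    ring
  have hY : ∑ k, p k * (Real.log 2 * (r k - D)) = 0 := by
    have : ∀ k, p k * (Real.log 2 * (r k - D)) = Real.log 2 * (p k * r k) - Real.log 2 * D * p k :=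
      fun k => by ring
    simp only [this, Finset.sum_sub_distrib, ← Finset.mul_sum, hp1, ← hDsum]
    ring
  have hcgf := log_sum_exp_le p (fun k => Real.log 2 * (r k - D))
    (jointWeight_nonneg hρ.1 hσ.1) hp1 hY hβ (by linarith)
  have hexp2 := hexp 2
  norm_num at hexp2
  rw [hexp α, hexp2] at hcgf
  have hV : ∑ k, p k * (Real.log 2 * (r k - D)) ^ 2 = Real.log 2 ^ 2 *
      (ρ * (mlog ρ - mlog σ - (D : ℂ) • (1 : Matrix n n ℂ)) ^ 2).trace.re := by
    rw [trace_mul_sq_mlog_sub_mlog hρ.1.1 hσ.1, Finset.mul_sum]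
    exact Finset.sum_congr rfl fun k _ => by ring
  rw [hV] at hcgf
  set V := (ρ * (mlog ρ - mlog σ - (D : ℂ) • (1 : Matrix n n ℂ)) ^ 2).trace.re
  have hpow : (2 : ℝ) ^ ((α - 1) * (Dpetz - D)) =
      petzTrace α ρ σ * (2 : ℝ) ^ (-((α - 1) * D)) := by
    have : (α - 1) * (Dpetz - D) = Real.logb 2 (petzTrace α ρ σ) + -((α - 1) * D) := by
      rw [hDpetz]
      field_simp
      ring
    rw [this, Real.rpow_add two_pos, Real.rpow_logb two_pos (by norm_num) hPpos]
  have hpow2 : (2 : ℝ) ^ (Dtwo - D) = petzTrace 2 ρ σ * (2 : ℝ) ^ (-D) := by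
    rw [sub_eq_add_neg, Real.rpow_add two_pos, hDtwo, Real.rpow_logb two_pos (by norm_num) hP2pos]
  rw [hpow, hpow2]
  set Q := petzTrace α ρ σ * (2 : ℝ) ^ (-((α - 1) * D)) with hQ
  set R := Real.log (petzTrace 2 ρ σ * (2 : ℝ) ^ (-D) + Real.exp 1 ^ 2) ^ 3
  have hlogQ : Real.log Q = Real.log (petzTrace α ρ σ) - (α - 1) * D * Real.log 2 := by
    rw [hQ, Real.log_mul hPpos.ne' (Real.rpow_pos_of_pos two_pos _).ne', Real.log_rpow two_pos]
    ring
  have hlogS : Real.log (sandwichedTrace α ρ σ) ≤ Real.log (petzTrace α ρ σ) :=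
    Real.log_le_log hSpos hle
  have hmain : Real.log (sandwichedTrace α ρ σ) ≤ (α - 1) * D * Real.log 2 +
      ((α - 1) ^ 2 / 2 * (Real.log 2 ^ 2 * V) +
        (α - 1) ^ 3 / (6 * (2 - α) ^ 3) * (Q * R)) := by
    have h2α : 1 - (α - 1) = 2 - α := by ring
    rw [h2α, hlogQ] at hcgf
    linarith
  have hα2 : 2 - α ≠ 0 := by linarith
  -- Division by `(α - 1) ln 2` lowers the cubic remainder to order `(α - 1)²` and leaves one factor
  -- `ln 2` on the variance.
  calc 1 / (α - 1) * Real.logb 2 (sandwichedTrace α ρ σ) =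
        1 / ((α - 1) * Real.log 2) * Real.log (sandwichedTrace α ρ σ) := by
        rw [Real.logb]; field_simp
    _ ≤ 1 / ((α - 1) * Real.log 2) * ((α - 1) * D * Real.log 2 +
      ((α - 1) ^ 2 / 2 * (Real.log 2 ^ 2 * V) +
        (α - 1) ^ 3 / (6 * (2 - α) ^ 3) * (Q * R))) :=
        mul_le_mul_of_nonneg_left hmain (by positivity)
    _ = _ := by field_simp; ring

/-! ### Bipartite operators: the support of `ρ` lies in that of `id_A ⊗ ρ_B`. -/

variable {A B : Type*} [Fintype A] [DecidableEq A] [Fintype B] [DecidableEq B]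

theorem marginalB_eq_sum (ρ : Matrix (A × B) (A × B) ℂ) :
    marginalB ρ = ∑ a, ρ.submatrix (Prod.mk a) (Prod.mk a) := by
  ext b b'
  simp [marginalB, Matrix.sum_apply]

theorem marginalB_posSemidef {ρ : Matrix (A × B) (A × B) ℂ} (hρ : ρ.PosSemidef) :
    (marginalB ρ).PosSemidef := by
  rw [marginalB_eq_sum]
  exact posSemidef_sum _ fun a _ => hρ.submatrix _

theorem idTensorMarginal_posSemidef {ρ : Matrix (A × B) (A × B) ℂ} (hρ : ρ.PosSemidef) :
    (idTensorMarginal ρ).PosSemidef :=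
  PosSemidef.one.kronecker (marginalB_posSemidef hρ)

/-- The kernel of `id_A ⊗ ρ_B` is contained in the kernel of `ρ`. -/
theorem mulVec_eq_zero_of_idTensorMarginal {ρ : Matrix (A × B) (A × B) ℂ} (hρ : ρ.PosSemidef)
    (v : A × B → ℂ) (hv : idTensorMarginal ρ *ᵥ v = 0) : ρ *ᵥ v = 0 := by
  have hB : ∀ a, marginalB ρ *ᵥ (fun b => v (a, b)) = 0 := fun a => by
    ext b
    have h := congrFun hv (a, b)
    simpa [idTensorMarginal, mulVec, dotProduct, Fintype.sum_prod_type, kroneckerMap_apply,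
      one_apply] using h
  -- For the slice `v_a` of `v`, `⟨v_a, ρ_B v_a⟩ = 0` is a sum over the diagonal blocks of `ρ` of
  -- nonnegative terms. The term of block `a` is the quadratic form of `ρ` at `v` restricted to that
  -- block, and a positive semidefinite form vanishes only on the kernel.
  have hblock : ∀ a, ρ *ᵥ (fun x => if x.1 = a then v x else 0) = 0 := fun a => by
    rw [← hρ.dotProduct_mulVec_zero_iff]
    have h1 : ∑ a', star (fun b => v (a, b)) ⬝ᵥ
        (ρ.submatrix (Prod.mk a') (Prod.mk a')) *ᵥ (fun b => v (a, b)) = 0 := by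
      rw [← dotProduct_sum, ← sum_mulVec, ← marginalB_eq_sum, hB a, dotProduct_zero]
    have h2 := (Finset.sum_eq_zero_iff_of_nonneg fun a' _ =>
      (hρ.submatrix (Prod.mk a')).dotProduct_mulVec_nonneg (fun b => v (a, b))).1 h1 a
        (Finset.mem_univ a)
    refine Eq.trans ?_ h2
    simp only [dotProduct, mulVec, Fintype.sum_prod_type, Pi.star_apply, submatrix_apply]
    rw [Finset.sum_eq_single a (fun a' _ h => by simp [h]) (by simp)]
    refine Finset.sum_congr rfl fun b _ => ?_
    rw [Finset.sum_eq_single a (fun a' _ h => by simp [h]) (by simp)]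
    simp
  have hsum : v = ∑ a, fun x => if x.1 = a then v x else 0 := by
    ext x
    simp [Finset.sum_apply]
  rw [hsum, mulVec_sum]
  exact Finset.sum_eq_zero fun a _ => hblock a

end QEntropy

end

theorem mainTheorem8 {A B : Type*} [Fintype A] [DecidableEq A] [Fintype B] [DecidableEq B]
    (ρ : Matrix (A × B) (A × B) ℂ) (hρ : QEntropy.IsDensity ρ)
    (α : ℝ) (hα : α ∈ Set.Ioo (1 : ℝ) 2) :
    ∃ H Hα H'α H'two : ℝ,
      QEntropy.condEntropy ρ = (H : EReal) ∧
      QEntropy.sandwichedCondEntropy α ρ = (Hα : EReal) ∧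
      QEntropy.petzCondEntropy α ρ = (H'α : EReal) ∧
      QEntropy.petzCondEntropy 2 ρ = (H'two : EReal) ∧
      Hα ≥ H - (α - 1) * Real.log 2 / 2 * QEntropy.condVariance ρ
        - (α - 1) ^ 2 *
          (1 / (6 * (2 - α) ^ 3 * Real.log 2) * (2 : ℝ) ^ ((α - 1) * (-H'α + H)) *
            Real.log ((2 : ℝ) ^ (-H'two + H) + Real.exp 1 ^ 2) ^ 3) := by
  have hker := QEntropy.mulVec_eq_zero_of_idTensorMarginal hρ.1
  have hsupp := QEntropy.supp_le_supp hker
  have hσ := QEntropy.idTensorMarginal_posSemidef hρ.1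
  set σ := QEntropy.idTensorMarginal ρ with hσdef
  have hα1 : α ≠ 1 := hα.1.ne'
  have hD : QEntropy.relEntropy ρ σ =
      (((ρ * (QEntropy.mlog ρ - QEntropy.mlog σ)).trace.re : ℝ) : EReal) := by
    rw [QEntropy.relEntropy, if_pos hsupp, hρ.2, Complex.one_re, div_one, one_mul]
  have hS : QEntropy.sandwichedDiv α ρ σ =
      ((1 / (α - 1) * Real.logb 2 (QEntropy.sandwichedTrace α ρ σ) : ℝ) : EReal) := by
    rw [QEntropy.sandwichedDiv, if_neg hα1, if_pos (Or.inr ⟨hα.1, hsupp⟩)]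
  have hP : QEntropy.petzDiv α ρ σ =
      ((1 / (α - 1) * Real.logb 2 (QEntropy.petzTrace α ρ σ) : ℝ) : EReal) := by
    rw [QEntropy.petzDiv, if_neg hα1, if_pos (Or.inr ⟨hα.1, hsupp⟩)]
  have hP2 : QEntropy.petzDiv 2 ρ σ =
      ((Real.logb 2 (QEntropy.petzTrace 2 ρ σ) : ℝ) : EReal) := by
    rw [QEntropy.petzDiv, if_neg (by norm_num), if_pos (Or.inr ⟨one_lt_two, hsupp⟩)]
    norm_num
  have hV : QEntropy.condVariance ρ = (ρ * (QEntropy.mlog ρ - QEntropy.mlog σ -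
      (((ρ * (QEntropy.mlog ρ - QEntropy.mlog σ)).trace.re : ℝ) : ℂ) •
        (1 : Matrix (A × B) (A × B) ℂ)) ^ 2).trace.re := by
    rw [QEntropy.condVariance, QEntropy.divVariance, hρ.2, Complex.one_re, div_one, one_mul, hD,
      EReal.toReal_coe]
  refine ⟨_, _, _, _, (congrArg Neg.neg hD).trans (EReal.coe_neg _).symm,
    (congrArg Neg.neg hS).trans (EReal.coe_neg _).symm,
    (congrArg Neg.neg hP).trans (EReal.coe_neg _).symm,
    (congrArg Neg.neg hP2).trans (EReal.coe_neg _).symm, ?_⟩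
  have h := QEntropy.sandwiched_second_order hρ hσ hker hα.1 hα.2 rfl rfl rfl
  rw [hV, neg_neg, neg_neg, ← sub_eq_add_neg, ← sub_eq_add_neg]
  linarith
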